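/- Let $X$ and $Y$ be compact metric spaces with Borel $\sigma$-algebras $\mathcal B(X)$, $\mathcal B(Y)$, and let $P_1$, $P_2$ be Borel probability measures on $X$ and $Y$. Let $\mathcal B(X)\otimes\mathcal B(Y)$ be the algebra of all finite unions of rectangles $A\times B$ with $A\in\mathcal B(X)$, $B\in\mathcal B(Y)$; let $\mathcal B(X)\otimes^\sigma\mathcal B(Y)$ be the $\sigma$-algebra generated by these rectangles; let $P_1\otimes^\sigma P_2$ be the product measure on it, and $P_1\otimes P_2$ its restriction to $\mathcal B(X)\otimes\mathcal B(Y)$. Let ${}^*$ be any nonstandard extension (that is, any extension satisfying the transfer principle). Write ${}^*\mathcal B(X)\otimes{}^*\mathcal B(Y)={}^*(\mathcal B(X)\otimes\mathcal B(Y))$ for the internal product algebra on ${}^*X\times{}^*Y$ (all hyperfinite unions of rectangles $A\times B$ with $A\in{}^*\mathcal B(X)$, $B\in{}^*\mathcal B(Y)$), ${}^*\mathcal B(X)\otimes^\sigma{}^*\mathcal B(Y)={}^*(\mathcal B(X)\otimes^\sigma\mathcal B(Y))$, ${}^*P_1\otimes^\sigma{}^*P_2={}^*(P_1\otimes^\sigma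 P_2)$ and ${}^*P_1\otimes{}^*P_2={}^*(P_1\otimes P_2)$. An internal set $E\in{}^*\mathcal B(X)\otimes^\sigma{}^*\mathcal B(Y)$ is called a ${}^*P_1\otimes^\sigma{}^*P_2$-continuity set if $({}^*P_1\otimes^\sigma{}^*P_2)({}^*\partial E)=0$, where ${}^*\partial$ is the nonstandard extension of the operation $A\mapsto\partial A$ taking a subset of $X\times Y$ to its topological boundary. Then every ${}^*P_1\otimes^\sigma{}^*P_2$-continuity set $E$ belongs to the Loeb algebra of $({}^*X\times{}^*Y,\ {}^*\mathcal B(X)\otimes{}^*\mathcal B(Y),\ {}^*P_1\otimes{}^*P_2)$; that is, with $\mathsf{st}$ the standard part map, $$\sup\{\mathsf{st}(({}^*P_1\otimes{}^*P_2)(A)) : A\in{}^*\mathcal B(X)\otimes{}^*\mathcal B(Y),\ A\subseteq E\}=\inf\{\mathsf{st}(({}^*P_1\otimes{}^*P_2)(C)) : C\in{}^*\mathcal B(X)\otimes{}^*\mathcal B(Y),\ E\subseteq C\}.$$ -/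

import Mathlib

open Set MeasureTheory

universe u v w

namespace NSA

/-! ### Nonstandard extensions: the full structure on a standard universe and its elementary
extensions -/

/-- The full language of a set `V`: one function symbol for every finitary function on `V` and one
relation symbol for every finitary relation on `V`. -/
def fullLanguage (V : Type u) : FirstOrder.Language.{u, u} where
  Functions n := (Fin n → V) → V
  Relations n := (Fin n → V) → Prop

/-- `V` as a structure for its full language: each symbol denotes itself. -/
instance fullStructure (V : Type u) : (fullLanguage V).Structure V where
  funMap f := f
  RelMap R := R

/-- The nonstandard extension `*p` of a property `p` of elements of `V`. -/
def starPred {V : Type u} (W : Type w) [(fullLanguage V).Structure W] (p : V → Prop) (a : W) :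
    Prop :=
  FirstOrder.Language.Structure.RelMap (L := fullLanguage V) (n := 1) (fun x => p (x 0)) ![a]

/-- The nonstandard extension `*R` of a binary relation on `V`. -/
def starRel₂ {V : Type u} (W : Type w) [(fullLanguage V).Structure W] (R : V → V → Prop)
    (a b : W) : Prop :=
  FirstOrder.Language.Structure.RelMap (L := fullLanguage V) (n := 2)
    (fun x => R (x 0) (x 1)) ![a, b]

/-- The nonstandard extension `*R` of a ternary relation on `V`. -/
def starRel₃ {V : Type u} (W : Type w) [(fullLanguage V).Structure W] (R : V → V → V → Prop)
    (a b c : W) : Prop :=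
  FirstOrder.Language.Structure.RelMap (L := fullLanguage V) (n := 3)
    (fun x => R (x 0) (x 1) (x 2)) ![a, b, c]

/-- The nonstandard extension `*f` of a function on `V`. -/
def starMap {V : Type u} (W : Type w) [(fullLanguage V).Structure W] (f : V → V) (a : W) : W :=
  FirstOrder.Language.Structure.funMap (L := fullLanguage V) (n := 1) (fun x => f (x 0)) ![a]

/-- The standard universe over `X` and `Y`: points of `X`, points of `Y`, subsets of `X × Y` and
real numbers. -/
inductive Entity (X : Type u) (Y : Type v) : Type (max u v)
  | pt₁ (x : X) : Entity X Y
  | pt₂ (y : Y) : Entity X Y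
  | set (A : Set (X × Y)) : Entity X Y
  | real (r : ℝ) : Entity X Y

/-- A nonstandard extension of the standard universe over `X` and `Y`: an elementary embedding
`* : V → W` of the full structure on the universe `V` into an arbitrary structure `W`. That it is
elementary is the transfer principle, for all first-order formulas over all relations and functions
on `V`. Every model of nonstandard analysis (superstructure embedding, ultrapower, with any degree
of saturation) gives such an embedding. -/
abbrev NonstandardExtension (X : Type u) (Y : Type v) (W : Type w)
    [(fullLanguage (Entity X Y)).Structure W] :=
  FirstOrder.Language.ElementaryEmbedding (fullLanguage (Entity X Y)) (Entity X Y) W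

section

variable {X : Type u} {Y : Type v}

/-- Being a member of the set system `𝒮`. -/
def Entity.inSystem (𝒮 : Set (Set (X × Y))) (a : Entity X Y) : Prop :=
  ∃ A ∈ 𝒮, a = .set A

/-- The membership relation `(x, y) ∈ A`. -/
def Entity.mem (x y a : Entity X Y) : Prop :=
  ∃ x' y' A, x = .pt₁ x' ∧ y = .pt₂ y' ∧ a = .set A ∧ (x', y') ∈ A

/-- The order of the real numbers. -/
def Entity.realLE (a b : Entity X Y) : Prop :=
  ∃ r s : ℝ, a = .real r ∧ b = .real s ∧ r ≤ s

/-- The set function `A ↦ μ A` (arguments that are not sets get the value `0`). -/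
noncomputable def Entity.measure [MeasurableSpace X] [MeasurableSpace Y] (μ : Measure (X × Y)) :
    Entity X Y → Entity X Y
  | .set A => .real (μ.real A)
  | _ => .real 0

/-- The operation `A ↦ ∂A` (arguments that are not sets are left alone). -/
def Entity.boundary [TopologicalSpace X] [TopologicalSpace Y] : Entity X Y → Entity X Y
  | .set A => .set (frontier A)
  | a => a

variable (X Y) (W : Type w) [(fullLanguage (Entity X Y)).Structure W]

/-- `*X`. -/
def StarX : Type w := {a : W // starPred W (fun e : Entity X Y => ∃ x, e = .pt₁ x) a}

/-- `*Y`. -/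
def StarY : Type w := {a : W // starPred W (fun e : Entity X Y => ∃ y, e = .pt₂ y) a}

/-- `*𝒮`, a collection of internal sets, for a system `𝒮` of subsets of `X × Y`. -/
def starSystem (𝒮 : Set (Set (X × Y))) : Set W := {a | starPred W (Entity.inSystem 𝒮) a}

variable {W}

/-- The subset `{(x, y) ∈ *X × *Y | (x, y) *∈ A}` of `*X × *Y` that an internal set `A` is. -/
def extent (A : W) : Set (StarX X Y W × StarY X Y W) :=
  {p | starRel₃ W (Entity.mem (X := X) (Y := Y)) p.1.1 p.2.1 A}

variable {X Y}

/-- The standard part of a finite hyperreal. -/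
noncomputable def st (star : NonstandardExtension X Y W) (a : W) : ℝ :=
  sSup {r : ℝ | starRel₂ W (Entity.realLE (X := X) (Y := Y)) (star (.real r)) a}

/-- The Loeb algebra of the internal finitely additive probability space `(*X × *Y, 𝒜, ν)`: the
(possibly external) sets `B ⊆ *X × *Y` with
`sup {st (ν A) | B ⊇ A ∈ 𝒜} = inf {st (ν C) | B ⊆ C ∈ 𝒜}`. -/
def loebAlgebra (star : NonstandardExtension X Y W) (𝒜 : Set W) (ν : W → W) :
    Set (Set (StarX X Y W × StarY X Y W)) :=
  {B | sSup {r : ℝ | ∃ A ∈ 𝒜, extent X Y A ⊆ B ∧ r = st star (ν A)} =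
    sInf {r : ℝ | ∃ C ∈ 𝒜, B ⊆ extent X Y C ∧ r = st star (ν C)}}

end

section

variable (X : Type u) (Y : Type v) [MeasurableSpace X] [MeasurableSpace Y]

/-- The product algebra (not σ-algebra): all finite unions of measurable rectangles. -/
def rectAlgebra : Set (Set (X × Y)) :=
  {E | ∃ F : Finset (Set X × Set Y), (∀ p ∈ F, MeasurableSet p.1 ∧ MeasurableSet p.2) ∧
    E = ⋃ p ∈ F, p.1 ×ˢ p.2}

/-- The product σ-algebra. -/
def sigmaAlgebra : Set (Set (X × Y)) := {E | MeasurableSet E}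

variable (W : Type w) [(fullLanguage (Entity X Y)).Structure W]

/-- The internal product algebra `*𝓑(X) ⊗ *𝓑(Y)`: by transfer, all hyperfinite unions of
rectangles `A × B` with `A ∈ *𝓑(X)`, `B ∈ *𝓑(Y)`. -/
def starProdAlgebra : Set W := starSystem X Y W (rectAlgebra X Y)

/-- The internal σ-product algebra `*𝓑(X) ⊗^σ *𝓑(Y)`. -/
def starSigmaProdAlgebra : Set W := starSystem X Y W (sigmaAlgebra X Y)

variable {X Y}

/-- The internal σ-product measure `*P₁ ⊗^σ *P₂`, with values in `*ℝ`. Its restriction to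
`*𝓑(X) ⊗ *𝓑(Y)` is the internal product measure `*P₁ ⊗ *P₂`. -/
noncomputable def starProdMeasure (P₁ : Measure X) (P₂ : Measure Y) : W → W :=
  starMap W (Entity.measure (P₁.prod P₂))

variable {W}

/-- `E` is a `*P₁ ⊗^σ *P₂`-continuity set: it belongs to `*𝓑(X) ⊗^σ *𝓑(Y)`, and its internal
boundary has internal measure zero. -/
def IsStarContinuitySet [TopologicalSpace X] [TopologicalSpace Y]
    (star : NonstandardExtension X Y W) (P₁ : Measure X) (P₂ : Measure Y) (E : W) : Prop :=
  E ∈ starSigmaProdAlgebra X Y W ∧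
    starProdMeasure W P₁ P₂ (starMap W (Entity.boundary (X := X) (Y := Y)) E) = star (.real 0)

end

end NSA

/-! In the standard world, a set with null boundary has interior and closure of equal measure.
Regularity gives a compact set inside the interior and an open set around the closure, both of
nearly that measure. A finite union of rectangles fits between a compact set and an open set
containing it, so the set is squeezed between two members of the product algebra whose measures
differ by at most `ε` (`exists_rectAlgebra_sandwich`).

For each fixed real `ε` this is a first-order statement about all sets, so it transfers
(`exists_starProdAlgebra_sandwich`). Taking standard parts, the outer infimum exceeds the inner
supremum by at most every real `ε > 0`; the other inequality is transferred monotonicity. No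
saturation is needed. -/

namespace NSA

/-! ### Approximation by finite unions of rectangles -/

section Approximation

variable {X : Type u} {Y : Type v} [MeasurableSpace X] [MeasurableSpace Y]

lemma empty_mem_rectAlgebra : (∅ : Set (X × Y)) ∈ rectAlgebra X Y :=
  ⟨∅, by simp, by simp⟩

lemma prod_mem_rectAlgebra {A : Set X} {B : Set Y} (hA : MeasurableSet A) (hB : MeasurableSet B) :
    A ×ˢ B ∈ rectAlgebra X Y :=
  ⟨{(A, B)}, by simp [hA, hB], by simp⟩

lemma union_mem_rectAlgebra {A B : Set (X × Y)} (hA : A ∈ rectAlgebra X Y)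
    (hB : B ∈ rectAlgebra X Y) : A ∪ B ∈ rectAlgebra X Y := by
  classical
  obtain ⟨F, hF, rfl⟩ := hA
  obtain ⟨G, hG, rfl⟩ := hB
  refine ⟨F ∪ G, fun p hp => ?_, (Finset.set_biUnion_union F G _).symm⟩
  rcases Finset.mem_union.1 hp with h | h
  exacts [hF p h, hG p h]

variable [TopologicalSpace X] [TopologicalSpace Y] [OpensMeasurableSpace X]
  [OpensMeasurableSpace Y]

/-- A finite union of measurable rectangles fits between a compact set and an open set. -/
lemma exists_rectAlgebra_between {K U : Set (X × Y)} (hK : IsCompact K) (hU : IsOpen U)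
    (hKU : K ⊆ U) : ∃ A ∈ rectAlgebra X Y, K ⊆ A ∧ A ⊆ U := by
  refine hK.induction_on (p := fun s => ∃ A ∈ rectAlgebra X Y, s ⊆ A ∧ A ⊆ U)
    ⟨∅, empty_mem_rectAlgebra, by simp, by simp⟩ ?_ ?_ ?_
  · rintro s t hst ⟨A, hA, htA, hAU⟩
    exact ⟨A, hA, hst.trans htA, hAU⟩
  · rintro s t ⟨A, hA, hsA, hAU⟩ ⟨B, hB, htB, hBU⟩
    exact ⟨A ∪ B, union_mem_rectAlgebra hA hB, union_subset_union hsA htB,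
      union_subset hAU hBU⟩
  · rintro ⟨x, y⟩ hxy
    obtain ⟨A, B, hA, hxA, hB, hyB, hAB⟩ :=
      mem_nhds_prod_iff'.1 (hU.mem_nhds (hKU hxy))
    exact ⟨A ×ˢ B, mem_nhdsWithin_of_mem_nhds (prod_mem_nhds (hA.mem_nhds hxA) (hB.mem_nhds hyB)),
      A ×ˢ B, prod_mem_rectAlgebra hA.measurableSet hB.measurableSet, subset_rfl, hAB⟩

end Approximation

/-- A set with null boundary is approximated from inside and outside by finite unions of
measurable rectangles. -/
lemma exists_rectAlgebra_sandwich {X : Type u} {Y : Type v}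
    [MetricSpace X] [CompactSpace X] [MeasurableSpace X] [BorelSpace X]
    [MetricSpace Y] [CompactSpace Y] [MeasurableSpace Y] [BorelSpace Y]
    (μ : Measure (X × Y)) [IsFiniteMeasure μ] {E : Set (X × Y)}
    (hE : μ.real (frontier E) = 0) {ε : ℝ} (hε : 0 < ε) :
    ∃ A ∈ rectAlgebra X Y, ∃ C ∈ rectAlgebra X Y, A ⊆ E ∧ E ⊆ C ∧ μ.real C ≤ μ.real A + ε := by
  -- Half of `ε` pays for the compact set inside the interior, half for the open set around the
  -- closure.
  have hδ : ENNReal.ofReal (ε / 2) ≠ 0 := by simpa using hε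
  obtain ⟨K, hKE, hK, hμK⟩ := (isOpen_interior (s := E)).measurableSet.exists_isCompact_lt_add
    (measure_ne_top μ _) hδ
  obtain ⟨U, hEU, hU, hμU⟩ := (closure E).exists_isOpen_lt_add (measure_ne_top μ _) hδ
  obtain ⟨A, hA, hKA, hAE⟩ := exists_rectAlgebra_between hK isOpen_interior hKE
  obtain ⟨C, hC, hEC, hCU⟩ := exists_rectAlgebra_between isClosed_closure.isCompact hU hEU
  refine ⟨A, hA, C, hC, hAE.trans interior_subset, subset_closure.trans hEC, ?_⟩
  have hfr : μ (frontier E) = 0 := (measureReal_eq_zero_iff).1 hE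
  have hcl : μ (closure E) ≤ μ (interior E) := by
    rw [closure_eq_interior_union_frontier]
    exact (measure_union_le _ _).trans (by simp [hfr])
  have key : μ C ≤ μ A + ENNReal.ofReal ε :=
    calc μ C ≤ μ (closure E) + ENNReal.ofReal (ε / 2) := (measure_mono hCU).trans hμU.le
      _ ≤ μ A + ENNReal.ofReal (ε / 2) + ENNReal.ofReal (ε / 2) := by
        gcongr
        exact hcl.trans (hμK.le.trans (by gcongr))
      _ = μ A + ENNReal.ofReal ε := by
        rw [add_assoc, ← ENNReal.ofReal_add (by positivity) (by positivity), add_halves]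
  have := ENNReal.toReal_mono (by finiteness) key
  rwa [ENNReal.toReal_add (by finiteness) (by finiteness), ENNReal.toReal_ofReal hε.le] at this

/-! ### Transfer of the first-order statements needed -/

section Transfer

open FirstOrder FirstOrder.Language

/-- The symbol of a unary function. -/
def sym₁ {V : Type u} (f : V → V) : (fullLanguage V).Functions 1 := fun x => f (x 0)

/-- The symbol of a unary relation. -/
def rel₁ {V : Type u} (p : V → Prop) : (fullLanguage V).Relations 1 := fun x => p (x 0)

/-- The symbol of a binary relation. -/
def rel₂ {V : Type u} (p : V → V → Prop) : (fullLanguage V).Relations 2 :=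
  fun x => p (x 0) (x 1)

/-- The symbol of a ternary relation. -/
def rel₃ {V : Type u} (p : V → V → V → Prop) : (fullLanguage V).Relations 3 :=
  fun x => p (x 0) (x 1) (x 2)

variable {V : Type u} {W : Type w} [(fullLanguage V).Structure W]

lemma funMap_sym₁ (f : V → V) (a : W) :
    Structure.funMap (sym₁ f) ![a] = starMap W f a := rfl

lemma relMap_rel₁ (p : V → Prop) (a : W) : Structure.RelMap (rel₁ p) ![a] = starPred W p a := rfl

lemma relMap_rel₂ (p : V → V → Prop) (a b : W) :
    Structure.RelMap (rel₂ p) ![a, b] = starRel₂ W p a b := rfl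

lemma relMap_rel₃ (p : V → V → V → Prop) (a b c : W) :
    Structure.RelMap (rel₃ p) ![a, b, c] = starRel₃ W p a b c := rfl

/-- In `V` every symbol denotes itself, so the standard side of a transferred formula simplifies to
the plain statement. -/
lemma starMap_self (f : V → V) (a : V) : starMap V f a = f a := rfl

lemma starPred_self (p : V → Prop) (a : V) : starPred V p a = p a := rfl

lemma starRel₂_self (p : V → V → Prop) (a b : V) : starRel₂ V p a b = p a b := rfl

lemma starRel₃_self (p : V → V → V → Prop) (a b c : V) : starRel₃ V p a b c = p a b c := rfl

/-- The atomic formula `p s t u`. -/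
def formula₃ {α : Type*} {n : ℕ} (p : V → V → V → Prop)
    (s t u : (fullLanguage V).Term (α ⊕ Fin n)) : (fullLanguage V).BoundedFormula α n :=
  (rel₃ p).boundedFormula ![s, t, u]

lemma realize_formula₃ {α : Type*} {n : ℕ} (p : V → V → V → Prop)
    (s t u : (fullLanguage V).Term (α ⊕ Fin n)) (v : α → W) (xs : Fin n → W) :
    (formula₃ p s t u).Realize v xs ↔
      starRel₃ W p (s.realize (Sum.elim v xs)) (t.realize (Sum.elim v xs))
        (u.realize (Sum.elim v xs)) := by
  rw [formula₃, BoundedFormula.realize_rel, ← relMap_rel₃]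
  refine iff_of_eq (congrArg _ ?_)
  ext i
  fin_cases i <;> rfl

variable (star : V ↪ₑ[fullLanguage V] W)

/-- The constant `d` is the value of a free variable, which the embedding sends to `star d`. This
serves to transfer `0 ≤ μ A`. -/
lemma starRel₂_star_starMap {p : V → V → Prop} {f : V → V} {d : V} (h : ∀ a, p d (f a)) (a : W) :
    starRel₂ W p (star d) (starMap W f a) := by
  let φ : (fullLanguage V).Formula Unit :=
    ∀' (rel₂ p).boundedFormula₂ (Term.var (Sum.inl ())) ((sym₁ f).apply₁ (&0))
  have hφ := star.map_formula φ (fun _ => d)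
  simp [φ, Formula.Realize, BoundedFormula.realize_rel₂, Fin.snoc, relMap_rel₂, starRel₂_self,
    funMap_sym₁, starMap_self] at hφ
  exact hφ.2 h a

lemma not_starRel₂_star_starMap {p : V → V → Prop} {f : V → V} {d : V} (h : ∀ a, ¬ p d (f a))
    (a : W) : ¬ starRel₂ W p (star d) (starMap W f a) := by
  let φ : (fullLanguage V).Formula Unit :=
    ∀' ∼((rel₂ p).boundedFormula₂ (Term.var (Sum.inl ())) ((sym₁ f).apply₁ (&0)))
  have hφ := star.map_formula φ (fun _ => d)
  simp [φ, Formula.Realize, BoundedFormula.realize_rel₂, Fin.snoc, relMap_rel₂, starRel₂_self,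
    funMap_sym₁, starMap_self] at hφ
  exact hφ.2 h a

/-- Serves to pass from `r ≤ a` and `a ≤ b + ε` to `r - ε ≤ b` without arithmetic in `W`. -/
lemma starRel₂_star_trans {p q t : V → V → Prop} {d e : V}
    (h : ∀ a b, p d a → q a b → t e b) {a b : W} :
    starRel₂ W p (star d) a → starRel₂ W q a b → starRel₂ W t (star e) b := by
  let φ : (fullLanguage V).Formula Bool :=
    ∀' ∀' ((rel₂ p).boundedFormula₂ (Term.var (Sum.inl true)) (&0) ⟹
      ((rel₂ q).boundedFormula₂ (&0) (&1) ⟹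
        (rel₂ t).boundedFormula₂ (Term.var (Sum.inl false)) (&1)))
  have hφ := star.map_formula φ (fun i => bif i then d else e)
  simp [φ, Formula.Realize, BoundedFormula.realize_rel₂, Fin.snoc, relMap_rel₂,
    starRel₂_self] at hφ
  exact hφ.2 h a b

include star

lemma starRel₃_imp_starPred {p : V → V → V → Prop} {q r : V → Prop}
    (h : ∀ a b c, p a b c → q a ∧ r b) {a b c : W} (hp : starRel₃ W p a b c) :
    starPred W q a ∧ starPred W r b := by
  let φ : (fullLanguage V).Sentence :=
    ∀' ∀' ∀' (formula₃ p (&0) (&1) (&2) ⟹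
      ((rel₁ q).boundedFormula₁ (&0) ⊓ (rel₁ r).boundedFormula₁ (&1)))
  have hφ := ElementaryEmbedding.map_sentence star φ
  simp [φ, Sentence.Realize, Formula.Realize, realize_formula₃,
    BoundedFormula.realize_rel₁, Fin.snoc, relMap_rel₁, starRel₃_self, starPred_self] at hφ
  exact hφ.1 h a b c hp

/-- Transfer of the monotonicity of a set function `f` on a set system `q`. -/
lemma starRel₂_starMap_mono {m : V → V → V → Prop} {q : V → Prop} {f : V → V}
    {r : V → V → Prop}
    (h : ∀ a b, q a → q b → (∀ x y, m x y a → m x y b) → r (f a) (f b)) {a b : W}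
    (ha : starPred W q a) (hb : starPred W q b)
    (hab : ∀ x y, starRel₃ W m x y a → starRel₃ W m x y b) :
    starRel₂ W r (starMap W f a) (starMap W f b) := by
  let φ : (fullLanguage V).Sentence :=
    ∀' ∀' ((rel₁ q).boundedFormula₁ (&0) ⟹ ((rel₁ q).boundedFormula₁ (&1) ⟹
      ((∀' ∀' (formula₃ m (&2) (&3) (&0) ⟹ formula₃ m (&2) (&3) (&1))) ⟹
        (rel₂ r).boundedFormula₂ ((sym₁ f).apply₁ (&0)) ((sym₁ f).apply₁ (&1)))))
  have hφ := ElementaryEmbedding.map_sentence star φ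
  simp [φ, Sentence.Realize, Formula.Realize, realize_formula₃, BoundedFormula.realize_rel₂,
    BoundedFormula.realize_rel₁, Fin.snoc, relMap_rel₁, relMap_rel₂, funMap_sym₁, starMap_self,
    starRel₂_self, starRel₃_self, starPred_self] at hφ
  exact hφ.1 h a b ha hb hab

/-- Transfer of the approximation, from inside and outside, of the sets `a` of a system `p` with
`f (g a) = d` by sets of a system `q`. -/
lemma exists_starPred_sandwich {m : V → V → V → Prop} {p q : V → Prop} {f g : V → V}
    {r : V → V → Prop} {d : V}
    (h : ∀ a, p a → f (g a) = d → ∃ b, q b ∧ ∃ c, q c ∧ (∀ x y, m x y b → m x y a) ∧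
      (∀ x y, m x y a → m x y c) ∧ r (f c) (f b)) {a : W}
    (ha : starPred W p a) (had : starMap W f (starMap W g a) = star d) :
    ∃ b, starPred W q b ∧ ∃ c, starPred W q c ∧ (∀ x y, starRel₃ W m x y b → starRel₃ W m x y a) ∧
      (∀ x y, starRel₃ W m x y a → starRel₃ W m x y c) ∧
      starRel₂ W r (starMap W f c) (starMap W f b) := by
  -- Here `&0` is the given set, `&1` and `&2` its inner and outer approximations, `&3` and `&4` the
  -- coordinates of a point.
  let φ : (fullLanguage V).Formula Unit :=
    ∀' ((rel₁ p).boundedFormula₁ (&0) ⟹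
      (((sym₁ f).apply₁ ((sym₁ g).apply₁ (&0)) =' Term.var (Sum.inl ())) ⟹
      ∃' ∃' ((rel₁ q).boundedFormula₁ (&1) ⊓ ((rel₁ q).boundedFormula₁ (&2) ⊓
        ((∀' ∀' (formula₃ m (&3) (&4) (&1) ⟹
          formula₃ m (&3) (&4) (&0))) ⊓
        ((∀' ∀' (formula₃ m (&3) (&4) (&0) ⟹
          formula₃ m (&3) (&4) (&2))) ⊓
        (rel₂ r).boundedFormula₂ ((sym₁ f).apply₁ (&2)) ((sym₁ f).apply₁ (&1))))))))
  have hφ := star.map_formula φ (fun _ => d)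
  simp [φ, Formula.Realize, realize_formula₃, BoundedFormula.realize_rel₂,
    BoundedFormula.realize_rel₁, Fin.snoc, relMap_rel₁, relMap_rel₂, funMap_sym₁, starMap_self,
    starRel₂_self, starRel₃_self, starPred_self] at hφ
  exact hφ.2 h a ha had

end Transfer

/-! ### Standard parts of internal measures and the Loeb algebra -/

section Loeb

variable {X : Type u} {Y : Type v} {W : Type w} [(fullLanguage (Entity X Y)).Structure W]

/-- `s ≤ r + ε`, as a relation between real numbers `r` and `s`. -/
def Entity.realLEAdd (ε : ℝ) (a b : Entity X Y) : Prop :=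
  ∃ r s : ℝ, a = .real r ∧ b = .real s ∧ r ≤ s + ε

section

variable (star : NonstandardExtension X Y W)
include star

/-- Transferred formulas quantify over all of `W`, extents only over `*X × *Y`. The two agree
because internal membership forces its first two arguments into `*X` and `*Y`. -/
lemma extent_subset_extent_iff {A B : W} : extent X Y A ⊆ extent X Y B ↔
    ∀ x y, starRel₃ W (Entity.mem (X := X) (Y := Y)) x y A →
      starRel₃ W (Entity.mem (X := X) (Y := Y)) x y B := by
  refine ⟨fun h x y hxy => ?_, fun h p hp => h _ _ hp⟩
  obtain ⟨hx, hy⟩ := starRel₃_imp_starPred star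
    (q := fun e : Entity X Y => ∃ x, e = .pt₁ x) (r := fun e : Entity X Y => ∃ y, e = .pt₂ y)
    (by rintro a b c ⟨x, y, A, rfl, rfl, -⟩; exact ⟨⟨x, rfl⟩, ⟨y, rfl⟩⟩) hxy
  exact h (a := (⟨x, hx⟩, ⟨y, hy⟩)) hxy

variable {a b : W}

/-- If `r` is a real lower bound of `a`, then `r - ε` is one of `b`. The first two hypotheses keep
the suprema defining `st` from taking default values. -/
lemma st_le_add {ε : ℝ}
    (ha : ∃ r : ℝ, starRel₂ W (Entity.realLE (X := X) (Y := Y)) (star (.real r)) a)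
    (hb : BddAbove {r : ℝ | starRel₂ W (Entity.realLE (X := X) (Y := Y)) (star (.real r)) b})
    (h : starRel₂ W (Entity.realLEAdd (X := X) (Y := Y) ε) a b) :
    st star a ≤ st star b + ε := by
  refine csSup_le ha fun r hr => sub_le_iff_le_add.1 (le_csSup hb ?_)
  refine starRel₂_star_trans (p := Entity.realLE) (q := Entity.realLEAdd ε) star ?_ hr h
  rintro _ _ ⟨r, s, ⟨⟩, rfl, hrs⟩ ⟨s', t, ⟨⟩, rfl, hst⟩
  exact ⟨_, _, rfl, rfl, by linarith⟩

section Measure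

variable [MeasurableSpace X] [MeasurableSpace Y] (P₁ : Measure X) [IsProbabilityMeasure P₁]
  (P₂ : Measure Y) [IsProbabilityMeasure P₂]

omit [IsProbabilityMeasure P₁] [IsProbabilityMeasure P₂] in
lemma zero_le_starProdMeasure (a : W) :
    starRel₂ W (Entity.realLE (X := X) (Y := Y)) (star (.real 0))
      (starProdMeasure W P₁ P₂ a) :=
  starRel₂_star_starMap star (fun e => by
    cases e <;> exact ⟨_, _, rfl, rfl, by positivity⟩) a

lemma bddAbove_starProdMeasure (a : W) :
    BddAbove {r : ℝ | starRel₂ W (Entity.realLE (X := X) (Y := Y)) (star (.real r))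
      (starProdMeasure W P₁ P₂ a)} := by
  refine ⟨1, fun r hr => ?_⟩
  -- For real `r > 1` no standard value of the measure is at least `r`, and this negation transfers.
  by_contra! h1
  refine not_starRel₂_star_starMap star (fun e => ?_) a hr
  rintro ⟨_, s, ⟨⟩, hs, hrs⟩
  have : s ≤ 1 := by
    cases e <;> cases hs
    case set => exact measureReal_le_one
    all_goals exact zero_le_one
  linarith

lemma st_starProdMeasure_le_add {a b : W} {ε : ℝ}
    (h : starRel₂ W (Entity.realLEAdd (X := X) (Y := Y) ε) (starProdMeasure W P₁ P₂ a)
      (starProdMeasure W P₁ P₂ b)) :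
    st star (starProdMeasure W P₁ P₂ a) ≤ st star (starProdMeasure W P₁ P₂ b) + ε :=
  st_le_add star ⟨0, zero_le_starProdMeasure star P₁ P₂ a⟩
    (bddAbove_starProdMeasure star P₁ P₂ b) h

lemma st_starProdMeasure_mono {𝒮 : Set (Set (X × Y))} {A C : W} (hA : A ∈ starSystem X Y W 𝒮)
    (hC : C ∈ starSystem X Y W 𝒮) (hAC : extent X Y A ⊆ extent X Y C) :
    st star (starProdMeasure W P₁ P₂ A) ≤ st star (starProdMeasure W P₁ P₂ C) := by
  have h := starRel₂_starMap_mono star (r := Entity.realLEAdd 0)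
    (q := Entity.inSystem 𝒮) (f := Entity.measure (P₁.prod P₂)) ?_ hA hC ((extent_subset_extent_iff star).1 hAC)
  · simpa using st_starProdMeasure_le_add star P₁ P₂ (ε := 0) h
  · rintro _ _ ⟨A, -, rfl⟩ ⟨C, -, rfl⟩ h
    refine ⟨_, _, rfl, rfl, ?_⟩
    rw [add_zero]
    refine measureReal_mono fun ⟨x, y⟩ hxy => ?_
    obtain ⟨x', y', C', ⟨⟩, ⟨⟩, ⟨⟩, h⟩ := h (.pt₁ x) (.pt₂ y) ⟨x, y, A, rfl, rfl, rfl, hxy⟩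
    exact h

end Measure

end

/-- Transfer of `exists_rectAlgebra_sandwich`. -/
lemma exists_starProdAlgebra_sandwich
    {X : Type u} {Y : Type v} {W : Type w} [(fullLanguage (Entity X Y)).Structure W]
    [MetricSpace X] [CompactSpace X] [MeasurableSpace X] [BorelSpace X]
    [MetricSpace Y] [CompactSpace Y] [MeasurableSpace Y] [BorelSpace Y]
    (star : NonstandardExtension X Y W)
    (P₁ : Measure X) [IsProbabilityMeasure P₁] (P₂ : Measure Y) [IsProbabilityMeasure P₂]
    {E : W} (hE : IsStarContinuitySet star P₁ P₂ E) {ε : ℝ} (hε : 0 < ε) :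
    ∃ A ∈ starProdAlgebra X Y W, ∃ C ∈ starProdAlgebra X Y W,
      extent X Y A ⊆ extent X Y E ∧ extent X Y E ⊆ extent X Y C ∧
        st star (starProdMeasure W P₁ P₂ C) ≤ st star (starProdMeasure W P₁ P₂ A) + ε := by
  -- The real `ε` is built into the relation symbol `realLEAdd ε`, so the only parameter of the
  -- transferred formula is the real `0`.
  have sandwich (a : Entity X Y) (ha : Entity.inSystem (sigmaAlgebra X Y) a)
      (had : Entity.measure (P₁.prod P₂) (Entity.boundary a) = .real 0) :
      ∃ b, Entity.inSystem (rectAlgebra X Y) b ∧ ∃ c, Entity.inSystem (rectAlgebra X Y) c ∧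
        (∀ x y, Entity.mem x y b → Entity.mem x y a) ∧
        (∀ x y, Entity.mem x y a → Entity.mem x y c) ∧
        Entity.realLEAdd ε (Entity.measure (P₁.prod P₂) c) (Entity.measure (P₁.prod P₂) b) := by
    obtain ⟨E, -, rfl⟩ := ha
    obtain ⟨A, hA, C, hC, hAE, hEC, h⟩ :=
      exists_rectAlgebra_sandwich (P₁.prod P₂) (Entity.real.inj had) hε
    have mem_mono {B D : Set (X × Y)} (hBD : B ⊆ D) (x y : Entity X Y) :
        Entity.mem x y (.set B) → Entity.mem x y (.set D) := by
      rintro ⟨x', y', _, rfl, rfl, ⟨⟩, h⟩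
      exact ⟨x', y', D, rfl, rfl, rfl, hBD h⟩
    exact ⟨.set A, ⟨A, hA, rfl⟩, .set C, ⟨C, hC, rfl⟩, mem_mono hAE, mem_mono hEC,
      _, _, rfl, rfl, h⟩
  obtain ⟨A, hA, C, hC, hAE, hEC, h⟩ := exists_starPred_sandwich star sandwich hE.1 hE.2
  exact ⟨A, hA, C, hC, (extent_subset_extent_iff star).2 hAE,
    (extent_subset_extent_iff star).2 hEC, st_starProdMeasure_le_add star P₁ P₂ h⟩

end Loeb
end NSA

theorem theorem4p5 {X : Type u} {Y : Type v}
    [MetricSpace X] [CompactSpace X] [MeasurableSpace X] [BorelSpace X]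
    [MetricSpace Y] [CompactSpace Y] [MeasurableSpace Y] [BorelSpace Y]
    (P₁ : Measure X) [IsProbabilityMeasure P₁] (P₂ : Measure Y) [IsProbabilityMeasure P₂]
    {W : Type w} [(NSA.fullLanguage (NSA.Entity X Y)).Structure W]
    (star : NSA.NonstandardExtension X Y W)
    (E : W) (hE : NSA.IsStarContinuitySet star P₁ P₂ E) :
    NSA.extent X Y E ∈
      NSA.loebAlgebra star (NSA.starProdAlgebra X Y W) (NSA.starProdMeasure W P₁ P₂) := by
  -- The tolerance `1` is arbitrary: only the nonemptiness of the two families is wanted.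
  obtain ⟨A₀, hA₀, C₀, hC₀, hA₀E, hEC₀, -⟩ :=
    NSA.exists_starProdAlgebra_sandwich star P₁ P₂ hE one_pos
  refine le_antisymm (csSup_le ⟨_, A₀, hA₀, hA₀E, rfl⟩ ?_) (le_of_forall_pos_le_add fun ε hε => ?_)
  · rintro _ ⟨A, hA, hAE, rfl⟩
    refine le_csInf ⟨_, C₀, hC₀, hEC₀, rfl⟩ ?_
    rintro _ ⟨C, hC, hEC, rfl⟩
    exact NSA.st_starProdMeasure_mono star P₁ P₂ hA hC (hAE.trans hEC)
  · obtain ⟨A, hA, C, hC, hAE, hEC, h⟩ :=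
      NSA.exists_starProdAlgebra_sandwich star P₁ P₂ hE hε
    -- By monotonicity, the inner set bounds all outer values from below and the outer set bounds
    -- all inner values from above.
    have hC_inf := csInf_le ⟨NSA.st star (NSA.starProdMeasure W P₁ P₂ A), ?_⟩
      (show _ ∈ {r : ℝ | ∃ C ∈ NSA.starProdAlgebra X Y W, NSA.extent X Y E ⊆ NSA.extent X Y C ∧
        r = NSA.st star (NSA.starProdMeasure W P₁ P₂ C)} from ⟨C, hC, hEC, rfl⟩)
    have hA_sup := le_csSup ⟨NSA.st star (NSA.starProdMeasure W P₁ P₂ C), ?_⟩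
      (show _ ∈ {r : ℝ | ∃ A ∈ NSA.starProdAlgebra X Y W, NSA.extent X Y A ⊆ NSA.extent X Y E ∧
        r = NSA.st star (NSA.starProdMeasure W P₁ P₂ A)} from ⟨A, hA, hAE, rfl⟩)
    · exact hC_inf.trans (h.trans (by gcongr))
    · rintro _ ⟨A', hA', hAE', rfl⟩
      exact NSA.st_starProdMeasure_mono star P₁ P₂ hA' hC (hAE'.trans hEC)
    · rintro _ ⟨C', hC', hEC', rfl⟩
      exact NSA.st_starProdMeasure_mono star P₁ P₂ hA hC' (hAE.trans hEC')
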